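/- **Setting.** Let $n,d_q,d_u,d_f\in\mathbb N=\{1,2,\dots\}$, let $\mathcal X\subset\mathbb R^{d_q}$ be bounded and measurable, and let $\Theta$ be a set. Each $\theta\in\Theta$ has locations $q_k(\theta)\in\mathbb R^{d_q}$ and observed objects $u_k(\theta)\in\mathbb R^{d_u}$ ($k=1,\dots,n$) and a continuous function $f_\theta:\mathcal X\to\mathbb R^{d_f}$. We observe $Y_k=u_k(\theta)+\varepsilon_k$, $k=1,\dots,n$, where $\varepsilon_1,\dots,\varepsilon_n$ are i.i.d. with a centered law $P^\varepsilon$ on $\mathbb R^{d_u}$; let $\Pr_\theta=\bigotimes_{k=1}^n(u_k(\theta)+P^\varepsilon)$ be the law of the observations, where $v+P^\varepsilon$ is $P^\varepsilon$ shifted by $v$. Assume that there is $C_{\rm noise}>0$ with $\mathrm{KL}(v_1+P^\varepsilon,v_2+P^\varepsilon)\le C_{\rm noise}|v_1-v_2|^2$ for all $v_1,v_2\in\mathbb R^{d_u}$. Norms $|\cdot|$ are Euclidean and $B(z,r)$ is the open ball. **(A) Alternatives.** Let $g:\mathbb R^{d_q}\to\mathbb R^{d_f}$ be continuous and zero outside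 $B(0,1)$, $v_0\in\mathbb R^{d_f}$, $\zeta,\rho^-,\rho^+>0$. There is $\theta_0\in\Theta$ with $f_{\theta_0}=v_0$ on $\mathcal X$, and for all $z\in\mathbb R^{d_q}$, $r\in[\rho^-,\rho^+)$ there is $\theta_{z,r}\in\Theta$ with $f_{\theta_{z,r}}(x)=r^\zeta g\big(\frac{x-z}r\big)+v_0$ for all $x\in\mathcal X$, such that for every $k$: if $q_k(\theta_0)\notin B(z,r)$, then $q_k(\theta_{z,r})=q_k(\theta_0)$ and $u_k(\theta_{z,r})=u_k(\theta_0)$; and if $q_k(\theta_{z,r})\notin B(z,r)$, then $u_k(\theta_{z,r})=u_k(\theta_0)$. **(B) Information bound.** With $$\psi_n(r)=\sup_{z\in\mathbb R^{d_q}}\max_{k}|u_k(\theta_{z,r})-u_k(\theta_0)|,\qquad \chi_n(r)=\sup_{z\in\mathbb R^{d_q}}\#\{k: q_k(\theta_{z,r})\in B(z,r)\},$$ there are $a_n,\gamma>0$ with $\psi_n(r)^2\chi_n(r)\le a_n r^\gamma$ for all $r\in[\rho^-,\rho^+)$. **(C) Packing.** Let $\eta(r)$ be the maximal $k$ for which there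 are $x_1,\dots,x_k\in\mathcal X$ with $B(x_j,r)\subset\mathcal X$ for all $j$ and $|x_j-x_i|\ge 2r$ for $i\ne j$. There is $C_{\rm pack}>0$ with $\eta(r)\ge C_{\rm pack}r^{-d_q}$ for all $r\in[\rho^-,\rho^+)$. **(D) Additivity.** If $r\in[\rho^-,\rho^+)$ and $z_1,\dots,z_J\in\mathbb R^{d_q}$, $J\in\mathbb N$, satisfy $|z_i-z_j|\ge2r$ for $i\neq j$, then there is $\theta\in\Theta$ with $f_\theta-f_{\theta_0}=\sum_{j=1}^J(f_{\theta_{z_j,r}}-f_{\theta_0})$ on $\mathcal X$ and, for all $k$, $u_k(\theta)-u_k(\theta_0)=\sum_{j=1}^J(u_k(\theta_{z_j,r})-u_k(\theta_0))$ and $q_k(\theta)-q_k(\theta_0)=\sum_{j=1}^J(q_k(\theta_{z_j,r})-q_k(\theta_0))$. **Theorem.** Assume (A) and (B). Infima range over all estimators $\hat f$ of $f_\theta$ based on $Y_1,\dots,Y_n$, i.e. all maps from the observations to functions on $\mathcal X$ with values in $\mathbb R^{d_f}$ (in (iii), to measurable functions); the probability of a non-measurable event is read as its outer measure. Write $\|g\|_\infty=\sup_x|g(x)|$.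 (i) Let $C_1=2C_{\rm noise}$, $C_2=\frac12\|g\|_\infty$, and assume $(\rho^-)^{-\gamma}\ge C_1a_n>(\rho^+)^{-\gamma}$. Then for all $x_0\in\mathcal X$ $$\inf_{\hat f}\sup_{\theta\in\Theta}\Pr_\theta\Big(|\hat f(x_0)-f_\theta(x_0)|\ge C_2(C_1a_n)^{-\zeta/\gamma}\Big)\ge\tfrac14 .$$ (ii) Assume (C). Let $C_1=\frac{12\gamma C_{\rm noise}}{d_q}$, $C_2=\frac12\|g\|_\infty$, and assume $(\rho^-)^{-\gamma}\ge C_1\frac{a_n}{\log a_n}>(\rho^+)^{-\gamma}$ and $a_n\ge\max\Big(2,\Big(\frac{d_q}{12\gamma C_{\rm noise}C_{\rm pack}^{\gamma/d_q}}\Big)^4\Big)$. Then $$\inf_{\hat f}\sup_{\theta\in\Theta}\Pr_\theta\Big(\sup_{x\in\mathcal X}|\hat f(x)-f_\theta(x)|\ge C_2\Big(C_1\frac{a_n}{\log a_n}\Big)^{-\zeta/\gamma}\Big)\ge\tfrac14 .$$ (iii) Let $p\in[1,\infty)$ and assume (C), (D). Let $C_1=36C_{\rm noise}$, $C_2=2^{-1-3/p}C_{\rm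 pack}^{1/p}\|g\|_{L^p(\mathbb R^{d_q})}$, and assume $(\rho^-)^{-\gamma}\ge C_1a_n>(\rho^+)^{-\gamma}$ and $C_1a_n\ge(\frac18C_{\rm pack})^{-\gamma/d_q}$. Then $$\inf_{\hat f}\sup_{\theta\in\Theta}\Pr_\theta\Big(\big\|\,|\hat f-f_\theta|\,\big\|_{L^p(\mathcal X)}\ge C_2(C_1a_n)^{-\zeta/\gamma}\Big)\ge\tfrac14 .$$ -/

import Mathlib

open MeasureTheory Metric Set
open scoped ENNReal

/-- The regression model `Y k = u k θ + ε k`, `k = 1, …, n`. Each parameter `θ` has locations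
`loc k θ`, observed objects `obs k θ` and a function `target θ` to be estimated on the domain of
interest. (Values of `target θ` outside `domain` are irrelevant.) -/
structure RegressionModel (n dq du df : ℕ) (Θ : Type*) where
  domain : Set (EuclideanSpace ℝ (Fin dq))
  measurableSet_domain : MeasurableSet domain
  isBounded_domain : Bornology.IsBounded domain
  loc : Fin n → Θ → EuclideanSpace ℝ (Fin dq)
  obs : Fin n → Θ → EuclideanSpace ℝ (Fin du)
  target : Θ → EuclideanSpace ℝ (Fin dq) → EuclideanSpace ℝ (Fin df)
  continuousOn_target : ∀ θ, ContinuousOn (target θ) domain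

/-- The noise condition: shifts of the law `P` satisfy
`KL(v₁ + P, v₂ + P) ≤ C * ‖v₁ - v₂‖ ^ 2`. -/
def NoiseCondition {d : ℕ} (P : Measure (EuclideanSpace ℝ (Fin d))) (C : ℝ) : Prop :=
  0 < C ∧ ∀ v₁ v₂ : EuclideanSpace ℝ (Fin d),
    InformationTheory.klDiv (P.map (fun x => v₁ + x)) (P.map (fun x => v₂ + x)) ≤
      ENNReal.ofReal (C * ‖v₁ - v₂‖ ^ 2)

/-- The minimax probability that the loss is at least `s`: the infimum over all estimators `F` in
the class `𝓔` of the supremum over all parameters. Estimators need not be measurable functions of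
the data: for an event which is not measurable, `P θ` is the outer measure. -/
noncomputable def minimaxProb {Ω Φ Θ : Type*} [MeasurableSpace Ω] (P : Θ → Measure Ω)
    (𝓔 : Set (Ω → Φ)) (loss : Φ → Θ → ℝ≥0∞) (s : ℝ≥0∞) : ℝ≥0∞ :=
  ⨅ F ∈ 𝓔, ⨆ θ, P θ {y | s ≤ loss (F y) θ}

namespace RegressionModel

variable {n dq du df : ℕ} {Θ : Type*} (M : RegressionModel n dq du df Θ)

/-- The law of `(Y 1, …, Y n)` under `θ` for i.i.d. noise with law `P`. -/
noncomputable def law (P : Measure (EuclideanSpace ℝ (Fin du))) (θ : Θ) :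
    Measure (Fin n → EuclideanSpace ℝ (Fin du)) :=
  Measure.pi fun k => P.map (fun x => M.obs k θ + x)

/-- The error `‖φ x₀ - f_θ x₀‖` of the estimate `φ` at the point `x₀`. -/
noncomputable def pointLoss (x₀ : EuclideanSpace ℝ (Fin dq))
    (φ : EuclideanSpace ℝ (Fin dq) → EuclideanSpace ℝ (Fin df)) (θ : Θ) : ℝ≥0∞ :=
  ‖φ x₀ - M.target θ x₀‖ₑ

/-- The supremum of the error over the domain of interest. -/
noncomputable def supLoss
    (φ : EuclideanSpace ℝ (Fin dq) → EuclideanSpace ℝ (Fin df)) (θ : Θ) : ℝ≥0∞ :=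
  ⨆ x ∈ M.domain, ‖φ x - M.target θ x‖ₑ

/-- The `L^p`-norm of the error over the domain of interest. -/
noncomputable def lpLoss (p : ℝ)
    (φ : EuclideanSpace ℝ (Fin dq) → EuclideanSpace ℝ (Fin df)) (θ : Θ) : ℝ≥0∞ :=
  eLpNorm (fun x => φ x - M.target θ x) (ENNReal.ofReal p) (volume.restrict M.domain)

/-- Estimators whose values are Lebesgue measurable functions on the domain of interest, so that
the `L^p`-loss is meaningful. -/
def measurableEstimators : Set ((Fin n → EuclideanSpace ℝ (Fin du)) →
    EuclideanSpace ℝ (Fin dq) → EuclideanSpace ℝ (Fin df)) :=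
  {F | ∀ y, AEStronglyMeasurable (F y) (volume.restrict M.domain)}

/-- The null hypothesis `θ₀` and the alternatives `alt z r` (that is, `θ_{z,r}`), with reference
function `g`, reference constant `v₀` and bump exponent `ζ`, for radii `r ∈ [ρlo, ρhi)`. -/
structure BumpAlternatives (g : EuclideanSpace ℝ (Fin dq) → EuclideanSpace ℝ (Fin df))
    (v₀ : EuclideanSpace ℝ (Fin df)) (θ₀ : Θ) (alt : EuclideanSpace ℝ (Fin dq) → ℝ → Θ)
    (ζ ρlo ρhi : ℝ) : Prop where
  continuous_ref : Continuous g
  support_ref : Function.support g ⊆ ball 0 1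
  exponent_pos : 0 < ζ
  lo_pos : 0 < ρlo
  hi_pos : 0 < ρhi
  target_null : ∀ x ∈ M.domain, M.target θ₀ x = v₀
  target_alt : ∀ z, ∀ r ∈ Ico ρlo ρhi, ∀ x ∈ M.domain,
    M.target (alt z r) x = r ^ ζ • g (r⁻¹ • (x - z)) + v₀
  /-- Locations which are outside the ball under `θ₀` are not affected. -/
  eq_of_null_notMem : ∀ z, ∀ r ∈ Ico ρlo ρhi, ∀ k, M.loc k θ₀ ∉ ball z r →
    M.loc k (alt z r) = M.loc k θ₀ ∧ M.obs k (alt z r) = M.obs k θ₀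
  /-- Observations located outside the ball under `θ_{z,r}` are not affected. -/
  obs_eq_of_alt_notMem : ∀ z, ∀ r ∈ Ico ρlo ρhi, ∀ k, M.loc k (alt z r) ∉ ball z r →
    M.obs k (alt z r) = M.obs k θ₀

/-- `ψ_n(r)`: the maximal distance of observed objects between null hypothesis and
alternatives. -/
noncomputable def psi (θ₀ : Θ) (alt : EuclideanSpace ℝ (Fin dq) → ℝ → Θ) (r : ℝ) : ℝ≥0∞ :=
  ⨆ z, ⨆ k, ‖M.obs k (alt z r) - M.obs k θ₀‖ₑ

/-- `χ_n(r)`: the maximal number of locations in the support of an alternative; the supremum is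
over natural numbers which are at most `n`. -/
noncomputable def chi (alt : EuclideanSpace ℝ (Fin dq) → ℝ → Θ) (r : ℝ) : ℕ :=
  ⨆ z, {k : Fin n | M.loc k (alt z r) ∈ ball z r}.ncard

/-- The information bound `ψ_n(r)² χ_n(r) ≤ a r^γ`. -/
def InformationBound (θ₀ : Θ) (alt : EuclideanSpace ℝ (Fin dq) → ℝ → Θ)
    (ρlo ρhi a γ : ℝ) : Prop :=
  0 < a ∧ 0 < γ ∧ ∀ r ∈ Ico ρlo ρhi,
    M.psi θ₀ alt r ^ 2 * (M.chi alt r : ℝ≥0∞) ≤ ENNReal.ofReal (a * r ^ γ)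

/-- `η(r)`: the maximal number of disjoint balls of radius `r` that fit into the domain of
interest (a bounded set of natural numbers for `r > 0`, `dq > 0`, as the domain is bounded). -/
noncomputable def eta (r : ℝ) : ℕ :=
  sSup {k : ℕ | ∃ x : Fin k → EuclideanSpace ℝ (Fin dq),
    (∀ j, x j ∈ M.domain) ∧ (∀ i j, i ≠ j → 2 * r ≤ ‖x i - x j‖) ∧ ∀ j, ball (x j) r ⊆ M.domain}

/-- The packing condition `η(r) ≥ c r^{-dq}`. -/
def PackingBound (ρlo ρhi c : ℝ) : Prop :=
  0 < c ∧ ∀ r ∈ Ico ρlo ρhi, c * r ^ (-(dq : ℝ)) ≤ (M.eta r : ℝ)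

/-- The additivity condition: alternatives with disjoint supports can be superposed. -/
def Additive (θ₀ : Θ) (alt : EuclideanSpace ℝ (Fin dq) → ℝ → Θ) (ρlo ρhi : ℝ) : Prop :=
  ∀ r ∈ Ico ρlo ρhi, ∀ (J : ℕ) (z : Fin J → EuclideanSpace ℝ (Fin dq)), 0 < J →
    (∀ i j, i ≠ j → 2 * r ≤ ‖z i - z j‖) →
    ∃ θ : Θ,
      (∀ x ∈ M.domain, M.target θ x - M.target θ₀ x =
        ∑ j, (M.target (alt (z j) r) x - M.target θ₀ x)) ∧
      (∀ k, M.obs k θ - M.obs k θ₀ = ∑ j, (M.obs k (alt (z j) r) - M.obs k θ₀)) ∧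
      (∀ k, M.loc k θ - M.loc k θ₀ = ∑ j, (M.loc k (alt (z j) r) - M.loc k θ₀))

end RegressionModel

/-! An estimator that errs by less than half the separation of two hypotheses distinguishes them, so
small risk is impossible when their laws are close. The noise condition and tensorization of KL turn
closeness into a sum of squared shifts `‖obs k θ - obs k θ₀‖ ^ 2`. A bump of radius `r` shifts at
most `chi` observations, each by at most `psi`, so it costs information at most `C * a * r ^ γ`,
while its height is of order `r ^ ζ`. With `r = A ^ (-1 / γ)`, `A` the quantity raised to `-ζ / γ`
in the rate, this information just fits the budget.

The budget depends on the loss. For the pointwise loss, two hypotheses allow information `1 / 2`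
(`quarter_le_minimaxProb_of_pair`, by Pinsker). For the supremum loss, the bumps on a packing by `J`
balls allow `log J / 2` (`quarter_le_minimaxProb_of_family`), which produces the logarithm. For the
`L^p` loss, superpositions of bumps indexed by a Gilbert-Varshamov code allow order `J`; as a
superposition costs at most `J` times a single bump, no logarithm is lost. -/

/-! ### Kullback-Leibler divergence: binary tests and product measures -/

section Information

open InformationTheory ProbabilityTheory

/-- Fenchel-Young inequality: `klFun` is the convex conjugate of `exp t - 1`. It is `1 + u ≤ exp u`
at `u = t - log x`, multiplied by `x`. -/
lemma mul_sub_exp_le_klFun {x : ℝ} (hx : 0 ≤ x) (t : ℝ) :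
    x * t - (Real.exp t - 1) ≤ klFun x := by
  rw [klFun_apply]
  rcases hx.eq_or_lt with rfl | hx
  · simpa using Real.exp_nonneg t
  · have h1 := Real.add_one_le_exp (t - Real.log x)
    have h2 : Real.exp t = x * Real.exp (t - Real.log x) := by
      rw [Real.exp_sub, Real.exp_log hx]; field_simp
    have h3 := mul_le_mul_of_nonneg_left h1 hx.le
    rw [← h2] at h3
    nlinarith

/-- The variational lower bound for the Kullback-Leibler divergence, for test functions which
take two values. -/
lemma variational_le_of_klDiv_le {α : Type*} [MeasurableSpace α] {μ ν : Measure α}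
    [IsProbabilityMeasure μ] [IsProbabilityMeasure ν] {c : ℝ} (hc : 0 ≤ c)
    (h : klDiv μ ν ≤ ENNReal.ofReal c) {A : Set α} (hA : MeasurableSet A) (s t : ℝ) :
    s * μ.real A + t * (1 - μ.real A) - (Real.exp s - 1) * ν.real A
      - (Real.exp t - 1) * (1 - ν.real A) ≤ c := by
  obtain ⟨hac, hint⟩ := klDiv_ne_top_iff.1 (ne_top_of_le_ne_top ENNReal.ofReal_ne_top h)
  have hle : (klDiv μ ν).toReal ≤ c := ENNReal.toReal_le_of_le_ofReal hc h
  rw [toReal_klDiv_eq_integral_klFun hac] at hle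
  have hkl := (integrable_klFun_rnDeriv_iff hac).2 hint
  -- The Fenchel-Young bound with constant slope `u`, integrated over `B`; it is used on `A` with
  -- `s` and on `Aᶜ` with `t`.
  have hset (B : Set α) (u : ℝ) : u * μ.real B - (Real.exp u - 1) * ν.real B
      ≤ ∫ x in B, klFun (μ.rnDeriv ν x).toReal ∂ν := by
    have hr : Integrable (fun x => (μ.rnDeriv ν x).toReal) (ν.restrict B) :=
      Measure.integrable_toReal_rnDeriv.integrableOn
    calc u * μ.real B - (Real.exp u - 1) * ν.real B
        = ∫ x in B, ((μ.rnDeriv ν x).toReal * u - (Real.exp u - 1)) ∂ν := by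
          rw [integral_sub (hr.mul_const u) (integrable_const _), integral_mul_const,
            Measure.setIntegral_toReal_rnDeriv hac]
          simp; ring
      _ ≤ _ := by
          refine integral_mono ((hr.mul_const u).sub (integrable_const _)) hkl.integrableOn ?_
          exact fun x => mul_sub_exp_le_klFun ENNReal.toReal_nonneg u
  have h1 := hset A s
  have h2 := hset Aᶜ t
  rw [probReal_compl_eq_one_sub hA, probReal_compl_eq_one_sub hA] at h2
  have h3 := integral_add_compl hA hkl
  linarith

/-- The Kullback-Leibler divergence of two Bernoulli distributions. -/
noncomputable def binaryKL (p q : ℝ) : ℝ :=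
  p * Real.log (p / q) + (1 - p) * Real.log ((1 - p) / (1 - q))

/-- The slopes `log (p / q) ≥ 0` and `log ((1 - p) / (1 - q)) ≤ 0` are optimal for the pair `(p,
q)`. Their signs make the variational bound increasing in `μ.real A` and decreasing in `ν.real A`,
so one-sided bounds on these probabilities suffice. -/
lemma binaryKL_le_of_klDiv_le {α : Type*} [MeasurableSpace α] {μ ν : Measure α}
    [IsProbabilityMeasure μ] [IsProbabilityMeasure ν] {c : ℝ} (hc : 0 ≤ c)
    (h : klDiv μ ν ≤ ENNReal.ofReal c) {A : Set α} (hA : MeasurableSet A) {p q : ℝ}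
    (hq : 0 < q) (hqp : q ≤ p) (hp : p < 1) (hμ : p ≤ μ.real A) (hν : ν.real A ≤ q) :
    binaryKL p q ≤ c := by
  have hp0 : 0 < p := hq.trans_le hqp
  have h1 : 0 < 1 - p := by linarith
  have h2 : 0 < 1 - q := by linarith
  have hv := variational_le_of_klDiv_le hc h hA (Real.log (p / q)) (Real.log ((1 - p) / (1 - q)))
  rw [Real.exp_log (by positivity), Real.exp_log (by positivity)] at hv
  have ha : 1 ≤ p / q := (one_le_div hq).2 hqp
  have hb : (1 - p) / (1 - q) ≤ 1 := (div_le_one h2).2 (by linarith)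
  have hs : 0 ≤ Real.log (p / q) := Real.log_nonneg ha
  have ht : Real.log ((1 - p) / (1 - q)) ≤ 0 := Real.log_nonpos (by positivity) hb
  have e : (p / q - 1) * q + ((1 - p) / (1 - q) - 1) * (1 - q) = 0 := by
    field_simp; ring
  unfold binaryKL
  nlinarith [mul_nonneg (sub_nonneg.2 hμ) (sub_nonneg.2 (ht.trans hs)),
    mul_nonneg (sub_nonneg.2 hν) (sub_nonneg.2 (hb.trans ha))]

/-- **Pinsker's inequality** for Bernoulli distributions. -/
lemma two_mul_sq_le_binaryKL {p q : ℝ} (hq : 0 < q) (hqp : q ≤ p) (hp : p < 1) :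
    2 * (p - q) ^ 2 ≤ binaryKL p q := by
  -- The second argument varies from `q` to `p`. Up to a constant, the function is `2 * (p - x) ^ 2
  -- - binaryKL p x`; it increases, and the difference vanishes at `x = p`.
  have hd (x : ℝ) (hx : x ∈ Icc q p) : HasDerivAt (fun x => p * Real.log x +
      (1 - p) * Real.log (1 - x) + 2 * (p - x) ^ 2)
      (p * x⁻¹ + (1 - p) * (-1 / (1 - x)) + 2 * (2 * (p - x) * (-1))) x := by
    have hx0 : x ≠ 0 := (hq.trans_le hx.1).ne'
    have hx1 : 1 - x ≠ 0 := by linarith [hx.2]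
    have h1 : HasDerivAt (fun x : ℝ => 1 - x) (-1) x := by
      simpa using (hasDerivAt_id x).const_sub 1
    have h2 : HasDerivAt (fun x : ℝ => p - x) (-1) x := by
      simpa using (hasDerivAt_id x).const_sub p
    have h3 := (((Real.hasDerivAt_log hx0).const_mul p).add ((h1.log hx1).const_mul (1 - p))).add
      ((h2.pow 2).const_mul 2)
    convert! h3 using 1
    norm_num
  have hmono : MonotoneOn (fun x => p * Real.log x +
      (1 - p) * Real.log (1 - x) + 2 * (p - x) ^ 2) (Icc q p) := by
    refine monotoneOn_of_deriv_nonneg (convex_Icc _ _)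
      (fun x hx => (hd x hx).continuousAt.continuousWithinAt)
      (fun x hx => (hd x (interior_subset hx)).differentiableAt.differentiableWithinAt) ?_
    intro x hx
    have hx' := interior_subset hx
    rw [(hd x hx').deriv]
    have hx0 : 0 < x := hq.trans_le hx'.1
    have hx1 : 0 < 1 - x := by linarith [hx'.2]
    have e : p * x⁻¹ + (1 - p) * (-1 / (1 - x)) + 2 * (2 * (p - x) * (-1))
        = (p - x) * (1 - 2 * x) ^ 2 / (x * (1 - x)) := by
      field_simp; ring
    rw [e]
    have := sub_nonneg.2 hx'.2
    positivity
  have h := hmono (left_mem_Icc.2 hqp) (right_mem_Icc.2 hqp) hqp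
  have hp0 : 0 < p := hq.trans_le hqp
  unfold binaryKL
  rw [Real.log_div hp0.ne' hq.ne', Real.log_div (by linarith) (by linarith)]
  simp only [sub_self] at h
  nlinarith

/-- The divergence is at least `3 / 4 * log m` plus a quarter of `3 * log 3 + log (1 / 4) = log (27
/ 4) > 0`. This constant keeps the inequality strict even at `m = 1`. -/
lemma half_log_lt_binaryKL {m : ℝ} (hm : 1 ≤ m) :
    1 / 2 * Real.log m < binaryKL (3 / 4) (1 / (4 * m)) := by
  have hm0 : 0 < m := by linarith
  have h1 : Real.log (1 / 4) ≤ Real.log ((1 - 3 / 4) / (1 - 1 / (4 * m))) := by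
    have h2 : 1 / (4 * m) < 1 := by rw [div_lt_one (by positivity)]; linarith
    apply Real.log_le_log (by norm_num)
    rw [le_div_iff₀ (by linarith)]
    have : 0 < 1 / (4 * m) := by positivity
    linarith
  have h3 : Real.log (3 / 4 / (1 / (4 * m))) = Real.log 3 + Real.log m := by
    rw [← Real.log_mul (by norm_num) hm0.ne']; congr 1; field_simp
  have h4 : 0 ≤ Real.log m := Real.log_nonneg hm
  have h5 : 0 < 3 * Real.log 3 + Real.log (1 / 4) := by
    have : 3 * Real.log 3 + Real.log (1 / 4) = Real.log (27 / 4) := by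
      rw [show (27 / 4 : ℝ) = 3 ^ 3 * (1 / 4) by norm_num,
        Real.log_mul (by norm_num) (by norm_num), Real.log_pow]
      norm_num
    rw [this]
    exact Real.log_pos (by norm_num)
  unfold binaryKL
  rw [h3]
  linarith

/-- The chain rule for constant kernels leaves the divergence of `μ.prod μ'` from `μ.prod ν'`.
Swapping the factors makes `μ` a common kernel, which drops out. -/
lemma klDiv_prod_le {α β : Type*} [MeasurableSpace α] [MeasurableSpace β]
    (μ ν : Measure α) (μ' ν' : Measure β) [IsProbabilityMeasure μ] [IsProbabilityMeasure ν]
    [IsProbabilityMeasure μ'] [IsProbabilityMeasure ν'] :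
    klDiv (μ.prod μ') (ν.prod ν') ≤ klDiv μ ν + klDiv μ' ν' := by
  have h := klDiv_compProd_eq_add μ ν (Kernel.const α μ') (Kernel.const α ν')
  simp only [Measure.compProd_const] at h
  rw [h]
  gcongr
  have h2 := klDiv_compProd_left μ' ν' (Kernel.const β μ)
  simp only [Measure.compProd_const] at h2
  have h3 := klDiv_map_le (μ'.prod μ) (ν'.prod μ) measurable_swap
  rwa [Measure.prod_swap, Measure.prod_swap, h2] at h3

lemma klDiv_pi_le {n : ℕ} {α : Type*} [MeasurableSpace α] (μ ν : Fin n → Measure α)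
    [∀ i, IsProbabilityMeasure (μ i)] [∀ i, IsProbabilityMeasure (ν i)] :
    klDiv (Measure.pi μ) (Measure.pi ν) ≤ ∑ i, klDiv (μ i) (ν i) := by
  induction n with
  | zero =>
    rw [Measure.pi_of_empty μ, Measure.pi_of_empty ν]
    simp
  | succ n ih =>
    rw [Fin.sum_univ_succAbove _ 0]
    have h1 := (measurePreserving_piFinSuccAbove μ 0).symm.map_eq
    have h2 := (measurePreserving_piFinSuccAbove ν 0).symm.map_eq
    rw [← h1, ← h2]
    calc _ ≤ _ := klDiv_map_le _ _ (MeasurableEquiv.measurable _)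
      _ ≤ _ := klDiv_prod_le _ _ _ _
      _ ≤ _ := by gcongr; exact ih _ _

end Information

/-! ### Reduction of minimax bounds to testing finitely many hypotheses -/

section Minimax

open InformationTheory

variable {Ω Φ Θ : Type*} [MeasurableSpace Ω] {P : Θ → Measure Ω} [∀ θ, IsProbabilityMeasure (P θ)]
  {𝓔 : Set (Ω → Φ)} {loss : Φ → Θ → ℝ≥0∞} {s : ℝ≥0∞}

/-- If the error probabilities of all parameters are less than `1 / 4`, then the events on which
the loss is small contain measurable events of probability more than `3 / 4`. -/
lemma quarter_le_minimaxProb (h : ∀ F ∈ 𝓔, ∀ B : Θ → Set Ω, (∀ θ, MeasurableSet (B θ)) →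
    (∀ θ, ∀ y ∈ B θ, loss (F y) θ < s) → (∀ θ, 3 / 4 < (P θ).real (B θ)) → False) :
    1 / 4 ≤ minimaxProb P 𝓔 loss s := by
  refine le_iInf₂ fun F hF => ?_
  by_contra! hlt
  have hθ (θ : Θ) : P θ {y | s ≤ loss (F y) θ} < 1 / 4 :=
    (le_iSup (fun θ => P θ {y | s ≤ loss (F y) θ}) θ).trans_lt hlt
  -- The measurable hull of the error event has the same outer measure, so its complement is a
  -- measurable part of the small-loss event.
  refine h F hF (fun θ => (toMeasurable (P θ) {y | s ≤ loss (F y) θ})ᶜ)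
    (fun θ => (measurableSet_toMeasurable _ _).compl) (fun θ y hy => ?_) (fun θ => ?_)
  · by_contra! hs
    exact hy (subset_toMeasurable _ _ hs)
  · rw [probReal_compl_eq_one_sub (measurableSet_toMeasurable _ _), measureReal_def,
      measure_toMeasurable]
    have : (P θ {y | s ≤ loss (F y) θ}).toReal < (1 / 4 : ℝ≥0∞).toReal :=
      ENNReal.toReal_strict_mono (by simp) (hθ θ)
    norm_num at this ⊢
    linarith

/-- Le Cam's two point method. -/
lemma quarter_le_minimaxProb_of_pair (θ₀ θ₁ : Θ)
    (hKL : klDiv (P θ₁) (P θ₀) ≤ ENNReal.ofReal (1 / 2))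
    (hsep : ∀ F ∈ 𝓔, ∀ y, loss (F y) θ₀ < s → loss (F y) θ₁ < s → False) :
    1 / 4 ≤ minimaxProb P 𝓔 loss s := by
  refine quarter_le_minimaxProb fun F hF B hB hlt hP => ?_
  have h0 : (P θ₀).real (B θ₁) ≤ (P θ₀).real (B θ₀)ᶜ :=
    measureReal_mono fun y hy hy' => hsep F hF y (hlt _ _ hy') (hlt _ _ hy)
  rw [probReal_compl_eq_one_sub (hB _)] at h0
  have h1 := hP θ₀
  have h2 := hP θ₁
  have h3 := measureReal_le_one (μ := P θ₁) (s := B θ₁)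
  have h4 := measureReal_nonneg (μ := P θ₀) (s := B θ₁)
  -- The gap exceeds `1 / 2` by `3 * δ > 0`. Moving both probabilities inwards by `δ` forces `p < 1`
  -- and `q > 0`, and the remaining gap `1 / 2 + δ` still contradicts Pinsker.
  obtain ⟨δ, hδ⟩ : ∃ δ, 3 * δ = (P θ₁).real (B θ₁) - (P θ₀).real (B θ₁) - 1 / 2 :=
    ⟨((P θ₁).real (B θ₁) - (P θ₀).real (B θ₁) - 1 / 2) / 3, by ring⟩
  have hb := binaryKL_le_of_klDiv_le (by norm_num) hKL (hB θ₁)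
    (p := (P θ₁).real (B θ₁) - δ) (q := (P θ₀).real (B θ₁) + δ)
    (by linarith) (by linarith) (by linarith) (by linarith) (by linarith)
  have hp := two_mul_sq_le_binaryKL (p := (P θ₁).real (B θ₁) - δ) (q := (P θ₀).real (B θ₁) + δ)
    (by linarith) (by linarith) (by linarith)
  have e : (P θ₁).real (B θ₁) - δ - ((P θ₀).real (B θ₁) + δ) = 1 / 2 + δ := by linarith
  rw [e] at hp
  nlinarith

/-- A lower bound by many hypotheses: `θ₀` and a finite family of alternatives. -/
lemma quarter_le_minimaxProb_of_family {ι : Type*} (t : Finset ι) (ht : t.Nonempty) (θ₀ : Θ)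
    (θ : ι → Θ)
    (hKL : ∀ i ∈ t, klDiv (P (θ i)) (P θ₀) ≤ ENNReal.ofReal (1 / 2 * Real.log t.card))
    (hsep₀ : ∀ F ∈ 𝓔, ∀ y, ∀ i ∈ t, loss (F y) θ₀ < s → loss (F y) (θ i) < s → False)
    (hsep : ∀ F ∈ 𝓔, ∀ y, ∀ i ∈ t, ∀ j ∈ t, i ≠ j →
      loss (F y) (θ i) < s → loss (F y) (θ j) < s → False) :
    1 / 4 ≤ minimaxProb P 𝓔 loss s := by
  refine quarter_le_minimaxProb fun F hF B hB hlt hP => ?_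
  have hcard : (1 : ℝ) ≤ t.card := by exact_mod_cast ht.card_pos
  -- The events of the alternatives are disjoint and avoid `B θ₀`; hence some alternative has null
  -- probability at most the average.
  have h0 : ∑ i ∈ t, (P θ₀).real (B (θ i)) ≤ 1 / 4 := by
    rw [← measureReal_biUnion_finset (fun i hi j hj hij => ?_) fun i _ => hB _]
    · have h1 : (P θ₀).real (⋃ i ∈ t, B (θ i)) ≤ (P θ₀).real (B θ₀)ᶜ := by
        refine measureReal_mono fun y hy hy' => ?_
        obtain ⟨i, hi, hy⟩ := mem_iUnion₂.1 hy
        exact hsep₀ F hF y i hi (hlt _ _ hy') (hlt _ _ hy)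
      rw [probReal_compl_eq_one_sub (hB _)] at h1
      linarith [hP θ₀]
    · exact disjoint_left.2 fun y hyi hyj =>
        hsep F hF y i hi j hj hij (hlt _ _ hyi) (hlt _ _ hyj)
  obtain ⟨i, hi, hle⟩ : ∃ i ∈ t, (P θ₀).real (B (θ i)) ≤ 1 / (4 * t.card) := by
    refine Finset.exists_le_of_sum_le ht (h0.trans ?_)
    simp only [Finset.sum_const, nsmul_eq_mul]
    apply le_of_eq
    field_simp
  have hlog := Real.log_nonneg hcard
  have hq : 1 / (4 * (t.card : ℝ)) ≤ 3 / 4 := by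
    rw [div_le_div_iff₀ (by positivity) (by norm_num)]; linarith
  have hb := binaryKL_le_of_klDiv_le (by positivity) (hKL i hi) (hB (θ i)) (p := 3 / 4)
    (by positivity) hq (by norm_num) (hP _).le hle
  exact absurd hb (not_le.2 (half_log_lt_binaryKL hcard))

end Minimax

/-! ### Gilbert-Varshamov codes -/

section Code

open Finset

/-- A Chernoff bound for the volume of Hamming balls. -/
lemma card_filter_card_lt_le (J : ℕ) (u : ℝ) :
    ((univ.filter fun S : Finset (Fin J) => (S.card : ℝ) < u).card : ℝ)
      ≤ 2 ^ u * (3 / 2) ^ J := by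
  -- The generating function `(1 + x) ^ J` at `x = 1 / 2`; each set counted below has weight at
  -- least `1` after multiplication by `2 ^ u`.
  have hsum : ∑ S : Finset (Fin J), (1 / 2 : ℝ) ^ S.card = (3 / 2) ^ J := by
    have h := Fintype.sum_pow_mul_eq_add_pow (Fin J) (1 / 2 : ℝ) 1
    simp only [one_pow, mul_one, Fintype.card_fin] at h
    rw [h]; norm_num
  rw [← hsum, Finset.card_eq_sum_ones, Nat.cast_sum, Finset.mul_sum]
  refine (Finset.sum_le_sum fun S hS => ?_).trans
    (Finset.sum_le_sum_of_subset_of_nonneg (Finset.filter_subset _ _) fun S _ _ => by positivity)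
  have hS' := (Finset.mem_filter.1 hS).2
  have h2 : (1 / 2 : ℝ) ^ S.card = 2 ^ (-(S.card : ℝ)) := by
    rw [Real.rpow_neg (by norm_num), Real.rpow_natCast]; simp
  rw [h2, ← Real.rpow_add (by norm_num)]
  simpa using Real.one_le_rpow (x := 2) (by norm_num) (by linarith : 0 ≤ u + -(S.card : ℝ))

/-- The **Gilbert-Varshamov bound**, for codes which consist of subsets of `Fin J`. -/
lemma exists_code {J : ℕ} (hJ : 8 ≤ J) : ∃ 𝒞 : Finset (Finset (Fin J)), 𝒞.Nonempty ∧
    (∀ S ∈ 𝒞, (J : ℝ) / 8 ≤ S.card) ∧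
    (∀ S ∈ 𝒞, ∀ T ∈ 𝒞, S ≠ T → (J : ℝ) / 8 ≤ (symmDiff S T).card) ∧
    (J : ℝ) / 18 ≤ Real.log 𝒞.card := by
  classical
  have hJ' : (8 : ℝ) ≤ J := by exact_mod_cast hJ
  -- A largest separated code covers the cube by balls of radius `J / 8`. It is required to contain
  -- `∅`, which is erased in the end: separation from `∅` becomes the lower bound on the size of the
  -- codewords.
  let codes : Finset (Finset (Finset (Fin J))) := univ.filter fun 𝒞 => ∅ ∈ 𝒞 ∧
    ∀ S ∈ 𝒞, ∀ T ∈ 𝒞, S ≠ T → (J : ℝ) / 8 ≤ (symmDiff S T).card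
  obtain ⟨𝒞, h𝒞, hmax⟩ := Finset.exists_max_image codes Finset.card
    ⟨{∅}, by simp +contextual [codes]⟩
  obtain ⟨h0, hsep⟩ := (Finset.mem_filter.1 h𝒞).2
  have hcover (T : Finset (Fin J)) : ∃ S ∈ 𝒞, ((symmDiff S T).card : ℝ) < J / 8 := by
    by_contra! hT
    have hT' : T ∉ 𝒞 := fun h => by
      have := hT T h
      simp only [symmDiff_self, Finset.bot_eq_empty, Finset.card_empty, Nat.cast_zero] at this
      linarith
    have hin : insert T 𝒞 ∈ codes := by
      refine Finset.mem_filter.2 ⟨mem_univ _, Finset.mem_insert_of_mem h0, ?_⟩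
      intro S hS S' hS' hne
      rcases Finset.mem_insert.1 hS with h | h <;> rcases Finset.mem_insert.1 hS' with h' | h'
      · exact absurd (h.trans h'.symm) hne
      · rw [h, symmDiff_comm]; exact hT _ h'
      · rw [h']; exact hT _ h
      · exact hsep _ h _ h' hne
    have := hmax _ hin
    rw [Finset.card_insert_of_notMem hT'] at this
    omega
  have hcount : (2 : ℝ) ^ J ≤ 𝒞.card * (2 ^ ((J : ℝ) / 8) * (3 / 2) ^ J) := by
    have h1 : (univ : Finset (Finset (Fin J))) ⊆ 𝒞.biUnion fun S =>
        (univ.filter fun R : Finset (Fin J) => (R.card : ℝ) < J / 8).image (symmDiff S) := by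
      intro T _
      obtain ⟨S, hS, hlt⟩ := hcover T
      refine Finset.mem_biUnion.2 ⟨S, hS, Finset.mem_image.2 ⟨symmDiff S T, ?_, ?_⟩⟩
      · exact Finset.mem_filter.2 ⟨mem_univ _, hlt⟩
      · exact symmDiff_symmDiff_cancel_left S T
    have h2 := (Finset.card_le_card h1).trans (Finset.card_biUnion_le_card_mul _ _ _
      fun S _ => Finset.card_image_le)
    rw [Finset.card_univ, Fintype.card_finset, Fintype.card_fin] at h2
    calc (2 : ℝ) ^ J ≤ 𝒞.card *
          ((univ.filter fun R : Finset (Fin J) => (R.card : ℝ) < J / 8).card : ℝ) := by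
          exact_mod_cast h2
      _ ≤ _ := by gcongr; exact card_filter_card_lt_le J _
  have hpos : (0 : ℝ) < 𝒞.card := by exact_mod_cast Finset.card_pos.2 ⟨_, h0⟩
  have hl2 : 0.69 < Real.log 2 := by linarith [Real.log_two_gt_d9]
  -- As `(3 / 2) ^ 5 ≤ 2 ^ 3`, the constant is `1 - 1 / 8 - 3 / 5 = 0.275`.
  have hlog : (0.275 * J) * Real.log 2 ≤ Real.log 𝒞.card := by
    have h1 := Real.log_le_log (by positivity) hcount
    rw [Real.log_mul hpos.ne' (by positivity), Real.log_mul (by positivity) (by positivity),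
      Real.log_rpow (by norm_num), Real.log_pow, Real.log_pow] at h1
    have h2 : 5 * Real.log (3 / 2) ≤ 3 * Real.log 2 := by
      rw [← Real.log_rpow (by norm_num), ← Real.log_rpow (by norm_num)]
      exact Real.log_le_log (by positivity) (by norm_num)
    nlinarith
  have hcard : (2 : ℝ) ≤ 𝒞.card := by
    rw [← Real.log_le_log_iff (by norm_num) hpos]
    nlinarith
  refine ⟨𝒞.erase ∅, ?_, fun S hS => ?_, fun S hS T hT => ?_, ?_⟩
  · rw [← Finset.card_pos, Finset.card_erase_of_mem h0]
    have : 2 ≤ 𝒞.card := by exact_mod_cast hcard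
    omega
  · have := hsep S (Finset.mem_of_mem_erase hS) ∅ h0 (Finset.ne_of_mem_erase hS)
    rwa [← Finset.bot_eq_empty, symmDiff_bot] at this
  · exact hsep S (Finset.mem_of_mem_erase hS) T (Finset.mem_of_mem_erase hT)
  · have h1 : ((𝒞.erase ∅).card : ℝ) = 𝒞.card - 1 := by
      rw [Finset.card_erase_of_mem h0, Nat.cast_sub (Finset.card_pos.2 ⟨_, h0⟩), Nat.cast_one]
    rw [h1]
    -- Erasing `∅` costs at most `log 2`; by `J ≥ 8` this is at most `0.125 * J * log 2`, and `0.15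
    -- * log 2` exceeds `1 / 18`.
    have h2 : Real.log (𝒞.card / 2) ≤ Real.log (𝒞.card - 1) :=
      Real.log_le_log (by positivity) (by linarith)
    rw [Real.log_div hpos.ne' (by norm_num)] at h2
    nlinarith

end Code

/-- The radius at which the separation of the hypotheses matches the information bound. -/
lemma exists_radius {A ρlo ρhi γ : ℝ} (hA : 0 < A) (hγ : 0 < γ) (hlo : 0 < ρlo) (hhi : 0 < ρhi)
    (h1 : A ≤ ρlo ^ (-γ)) (h2 : ρhi ^ (-γ) < A) :
    ∃ r ∈ Ico ρlo ρhi, ∀ ξ : ℝ, A ^ (-ξ / γ) = r ^ ξ := by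
  have key (ρ : ℝ) (hρ : 0 < ρ) : (ρ ^ (-γ)) ^ (-1 / γ) = ρ := by
    rw [← Real.rpow_mul hρ.le]
    rw [show -γ * (-1 / γ) = 1 by field_simp, Real.rpow_one]
  have hneg : -1 / γ < 0 := div_neg_of_neg_of_pos (by norm_num) hγ
  refine ⟨A ^ (-1 / γ), ⟨?_, ?_⟩, fun ξ => ?_⟩
  · rw [← key ρlo hlo]
    exact Real.rpow_le_rpow_of_nonpos hA h1 hneg.le
  · rw [← key ρhi hhi]
    exact Real.rpow_lt_rpow_of_neg (by positivity) h2 hneg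
  · rw [← Real.rpow_mul hA.le]
    congr 1; field_simp

/-- There are no cross terms. This makes the information additive over disjoint bumps, as each
observation is shifted by at most one of them. -/
lemma enorm_sum_sq_le {ι E : Type*} [NormedAddCommGroup E] (s : Finset ι) (d : ι → E)
    (h : ∀ i ∈ s, ∀ j ∈ s, d i ≠ 0 → d j ≠ 0 → i = j) :
    ‖∑ i ∈ s, d i‖ₑ ^ 2 ≤ ∑ i ∈ s, ‖d i‖ₑ ^ 2 := by
  by_cases h0 : ∃ i ∈ s, d i ≠ 0
  · obtain ⟨i, hi, hd⟩ := h0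
    rw [Finset.sum_eq_single_of_mem i hi fun j hj hji => by
      by_contra hj0; exact hji (h j hj i hi hj0 hd)]
    exact Finset.single_le_sum (f := fun i => ‖d i‖ₑ ^ 2) (fun _ _ => zero_le) hi
  · push Not at h0
    rw [Finset.sum_eq_zero h0, enorm_zero, zero_pow two_ne_zero]
    exact zero_le

/-! ### Information and packing in the regression model -/

namespace RegressionModel

open InformationTheory

variable {n dq du df : ℕ} {Θ : Type*} (M : RegressionModel n dq du df Θ)
  {P : Measure (EuclideanSpace ℝ (Fin du))} [IsProbabilityMeasure P]
  {g : EuclideanSpace ℝ (Fin dq) → EuclideanSpace ℝ (Fin df)} {v₀ : EuclideanSpace ℝ (Fin df)}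
  {θ₀ : Θ} {alt : EuclideanSpace ℝ (Fin dq) → ℝ → Θ} {ζ ρlo ρhi a γ C : ℝ}

instance isProbabilityMeasure_map_add (v : EuclideanSpace ℝ (Fin du)) :
    IsProbabilityMeasure (P.map fun x => v + x) :=
  Measure.isProbabilityMeasure_map (by fun_prop)

instance isProbabilityMeasure_law (θ : Θ) : IsProbabilityMeasure (M.law P θ) := by
  unfold law; infer_instance

lemma klDiv_law_le (hP : NoiseCondition P C) (θ θ' : Θ) :
    klDiv (M.law P θ) (M.law P θ')
      ≤ ENNReal.ofReal C * ∑ k, ‖M.obs k θ - M.obs k θ'‖ₑ ^ 2 := by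
  refine (klDiv_pi_le _ _).trans ?_
  rw [Finset.mul_sum]
  refine Finset.sum_le_sum fun k _ => (hP.2 _ _).trans_eq ?_
  rw [ENNReal.ofReal_mul hP.1.le, ENNReal.ofReal_pow (norm_nonneg _), ofReal_norm]

/-- An unbounded supremum in `ℕ` would be `0`; boundedness makes `chi` dominate every count. -/
lemma bddAbove_chi (alt : EuclideanSpace ℝ (Fin dq) → ℝ → Θ) (r : ℝ) :
    BddAbove (range fun z => {k : Fin n | M.loc k (alt z r) ∈ ball z r}.ncard) := by
  refine ⟨n, ?_⟩
  rintro _ ⟨z, rfl⟩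
  simpa [Nat.card_eq_fintype_card] using
    Set.ncard_le_ncard (subset_univ {k : Fin n | M.loc k (alt z r) ∈ ball z r})

/-- The location under the alternative is the one counted by `chi`; the location under `θ₀`, common
to all alternatives, separates disjoint bumps. -/
lemma BumpAlternatives.loc_mem_ball {M : RegressionModel n dq du df Θ}
    (hb : M.BumpAlternatives g v₀ θ₀ alt ζ ρlo ρhi) {r : ℝ} (hr : r ∈ Ico ρlo ρhi)
    {z : EuclideanSpace ℝ (Fin dq)} {k : Fin n} (h : M.obs k (alt z r) - M.obs k θ₀ ≠ 0) :
    M.loc k θ₀ ∈ ball z r ∧ M.loc k (alt z r) ∈ ball z r := by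
  constructor <;> by_contra h0 <;> apply h <;> rw [sub_eq_zero]
  · exact (hb.eq_of_null_notMem z r hr k h0).2
  · exact hb.obs_eq_of_alt_notMem z r hr k h0

lemma BumpAlternatives.sum_sq_le {M : RegressionModel n dq du df Θ}
    (hb : M.BumpAlternatives g v₀ θ₀ alt ζ ρlo ρhi)
    (hi : M.InformationBound θ₀ alt ρlo ρhi a γ) {r : ℝ} (hr : r ∈ Ico ρlo ρhi)
    (z : EuclideanSpace ℝ (Fin dq)) :
    ∑ k, ‖M.obs k (alt z r) - M.obs k θ₀‖ₑ ^ 2 ≤ ENNReal.ofReal (a * r ^ γ) := by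
  classical
  refine le_trans ?_ (hi.2.2 r hr)
  have h1 : ∑ k, ‖M.obs k (alt z r) - M.obs k θ₀‖ₑ ^ 2
      = ∑ k with M.loc k (alt z r) ∈ ball z r, ‖M.obs k (alt z r) - M.obs k θ₀‖ₑ ^ 2 := by
    symm
    refine Finset.sum_filter_of_ne fun k _ hk => (hb.loc_mem_ball hr fun h0 => hk ?_).2
    simp [h0]
  rw [h1]
  calc _ ≤ ∑ k with M.loc k (alt z r) ∈ ball z r, M.psi θ₀ alt r ^ 2 := by
        refine Finset.sum_le_sum fun k _ => ?_
        gcongr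
        exact le_iSup₂ (f := fun z k => ‖M.obs k (alt z r) - M.obs k θ₀‖ₑ) z k
    _ ≤ _ := by
        rw [Finset.sum_const, nsmul_eq_mul, mul_comm]
        gcongr
        refine le_trans (le_of_eq ?_) (le_ciSup (M.bddAbove_chi alt r) z)
        rw [Set.ncard_eq_toFinset_card', Set.toFinset_ofPred]

/-- The information in the observations for the separation of an alternative from the null
hypothesis. -/
lemma BumpAlternatives.klDiv_alt_le {M : RegressionModel n dq du df Θ}
    (hP : NoiseCondition P C) (hb : M.BumpAlternatives g v₀ θ₀ alt ζ ρlo ρhi)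
    (hi : M.InformationBound θ₀ alt ρlo ρhi a γ) {r : ℝ} (hr : r ∈ Ico ρlo ρhi)
    (z : EuclideanSpace ℝ (Fin dq)) :
    klDiv (M.law P (alt z r)) (M.law P θ₀) ≤ ENNReal.ofReal (C * (a * r ^ γ)) := by
  rw [ENNReal.ofReal_mul hP.1.le]
  refine (M.klDiv_law_le hP _ _).trans ?_
  gcongr
  exact hb.sum_sq_le hi hr z

/-- The information in the observations for superpositions of alternatives with disjoint
supports. -/
lemma BumpAlternatives.klDiv_superposition_le {M : RegressionModel n dq du df Θ}
    (hP : NoiseCondition P C) (hb : M.BumpAlternatives g v₀ θ₀ alt ζ ρlo ρhi)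
    (hi : M.InformationBound θ₀ alt ρlo ρhi a γ) {r : ℝ} (hr : r ∈ Ico ρlo ρhi) {J : ℕ}
    {z : Fin J → EuclideanSpace ℝ (Fin dq)} (hz : ∀ i j, i ≠ j → 2 * r ≤ ‖z i - z j‖)
    (S : Finset (Fin J)) {θ : Θ}
    (hθ : ∀ k, M.obs k θ - M.obs k θ₀ = ∑ j ∈ S, (M.obs k (alt (z j) r) - M.obs k θ₀)) :
    klDiv (M.law P θ) (M.law P θ₀) ≤ ENNReal.ofReal (J * (C * (a * r ^ γ))) := by
  have hr0 : 0 < r := hb.lo_pos.trans_le hr.1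
  refine (M.klDiv_law_le hP _ _).trans ?_
  rw [ENNReal.ofReal_mul (by positivity), ENNReal.ofReal_mul hP.1.le, ENNReal.ofReal_natCast,
    mul_left_comm]
  gcongr
  calc ∑ k, ‖M.obs k θ - M.obs k θ₀‖ₑ ^ 2
      ≤ ∑ k, ∑ j ∈ S, ‖M.obs k (alt (z j) r) - M.obs k θ₀‖ₑ ^ 2 := by
        refine Finset.sum_le_sum fun k _ => ?_
        rw [hθ]
        refine enorm_sum_sq_le _ _ fun i _ j _ hdi hdj => ?_
        by_contra hij
        have h1 := mem_ball.1 (hb.loc_mem_ball hr hdi).1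
        have h2 := mem_ball.1 (hb.loc_mem_ball hr hdj).1
        have h3 := hz i j hij
        rw [← dist_eq_norm] at h3
        linarith [dist_triangle_left (z i) (z j) (M.loc k θ₀)]
    _ = ∑ j ∈ S, ∑ k, ‖M.obs k (alt (z j) r) - M.obs k θ₀‖ₑ ^ 2 := Finset.sum_comm
    _ ≤ ∑ j ∈ S, ENNReal.ofReal (a * r ^ γ) := Finset.sum_le_sum fun j _ => hb.sum_sq_le hi hr _
    _ ≤ J * ENNReal.ofReal (a * r ^ γ) := by
        rw [Finset.sum_const, nsmul_eq_mul]
        gcongr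
        simpa using Finset.card_le_univ S

lemma PackingBound.exists_packing {M : RegressionModel n dq du df Θ} {c r : ℝ}
    (hp : M.PackingBound ρlo ρhi c) (hr : r ∈ Ico ρlo ρhi) (hr0 : 0 < r) :
    ∃ (J : ℕ) (x : Fin J → EuclideanSpace ℝ (Fin dq)), c * r ^ (-(dq : ℝ)) ≤ J ∧
      (∀ i j, i ≠ j → 2 * r ≤ ‖x i - x j‖) ∧ ∀ j, ball (x j) r ⊆ M.domain := by
  have h := hp.2 r hr
  have hpos : 0 < M.eta r := by
    have := hp.1
    exact Nat.cast_pos.1 (lt_of_lt_of_le (by positivity) h)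
  have hmem := Nat.sSup_mem (s := {k : ℕ | ∃ x : Fin k → EuclideanSpace ℝ (Fin dq),
    (∀ j, x j ∈ M.domain) ∧ (∀ i j, i ≠ j → 2 * r ≤ ‖x i - x j‖) ∧ ∀ j, ball (x j) r ⊆ M.domain})
    -- The supremum is attained since the set is bounded: otherwise `eta` would take the default
    -- value `0`, but it is positive.
    ⟨0, Fin.elim0, by simp⟩ (by
      by_contra hbdd
      exact hpos.ne' (Nat.sSup_of_not_bddAbove hbdd))
  obtain ⟨x, -, h2, h3⟩ := hmem
  exact ⟨_, x, h, h2, h3⟩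

/-- A continuous function with support in the unit ball attains its supremum there. -/
lemma BumpAlternatives.exists_enorm_eq_iSup {M : RegressionModel n dq du df Θ}
    (hb : M.BumpAlternatives g v₀ θ₀ alt ζ ρlo ρhi) :
    ∃ y ∈ ball (0 : EuclideanSpace ℝ (Fin dq)) 1, ‖g y‖ₑ = ⨆ x, ‖g x‖ₑ := by
  obtain ⟨y, -, hy⟩ := (isCompact_closedBall (0 : EuclideanSpace ℝ (Fin dq)) 1).exists_isMaxOn
    ⟨0, by simp⟩ (hb.continuous_ref.enorm.continuousOn)
  have hmax (x) : ‖g x‖ₑ ≤ ‖g y‖ₑ := by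
    by_cases hx : x ∈ ball (0 : EuclideanSpace ℝ (Fin dq)) 1
    · exact hy (ball_subset_closedBall hx)
    · have : g x = 0 := by
        by_contra h; exact hx (hb.support_ref h)
      simp [this]
  -- If the maximum is `0`, the maximizer may lie on the sphere, and the center replaces it.
  by_cases hy0 : g y = 0
  · refine ⟨0, by simp, le_antisymm (le_iSup (fun x => ‖g x‖ₑ) 0) (iSup_le fun x => ?_)⟩
    refine (hmax x).trans ?_
    simp [hy0]
  · exact ⟨y, hb.support_ref hy0, le_antisymm (le_iSup (fun x => ‖g x‖ₑ) y) (iSup_le hmax)⟩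

end RegressionModel

/-! ### Rescaled bumps and their superpositions -/

section Bump

variable {dq df : ℕ} {g : EuclideanSpace ℝ (Fin dq) → EuclideanSpace ℝ (Fin df)}

/-- The bump `g`, rescaled to the ball with center `z` and radius `r`. -/
noncomputable def bump (g : EuclideanSpace ℝ (Fin dq) → EuclideanSpace ℝ (Fin df)) (ζ r : ℝ)
    (z x : EuclideanSpace ℝ (Fin dq)) : EuclideanSpace ℝ (Fin df) :=
  r ^ ζ • g (r⁻¹ • (x - z))

lemma bump_eq_zero (hg : Function.support g ⊆ ball 0 1) (ζ : ℝ) {r : ℝ} (hr : 0 < r)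
    {z x : EuclideanSpace ℝ (Fin dq)} (hx : x ∉ ball z r) : bump g ζ r z x = 0 := by
  have : g (r⁻¹ • (x - z)) = 0 := by
    by_contra h
    have h1 := mem_ball_zero_iff.1 (hg h)
    rw [norm_smul, norm_inv, Real.norm_of_nonneg hr.le, inv_mul_lt_one₀ hr] at h1
    exact hx (mem_ball_iff_norm.2 h1)
  rw [bump, this, smul_zero]

lemma enorm_bump (ζ : ℝ) {r : ℝ} (hr : 0 < r) (z x : EuclideanSpace ℝ (Fin dq)) :
    ‖bump g ζ r z x‖ₑ = ENNReal.ofReal (r ^ ζ) * ‖g (r⁻¹ • (x - z))‖ₑ := by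
  rw [bump, enorm_smul, Real.enorm_of_nonneg (by positivity)]

lemma bump_add_smul (ζ : ℝ) {r : ℝ} (hr : 0 < r) (z y : EuclideanSpace ℝ (Fin dq)) :
    ‖bump g ζ r z (z + r • y)‖ₑ = ENNReal.ofReal (r ^ ζ) * ‖g y‖ₑ := by
  rw [enorm_bump ζ hr, add_sub_cancel_left, inv_smul_smul₀ hr.ne']

lemma lintegral_comp_rescale {f : EuclideanSpace ℝ (Fin dq) → ℝ≥0∞} (hf : Measurable f) {r : ℝ}
    (hr : 0 < r) (z : EuclideanSpace ℝ (Fin dq)) :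
    ∫⁻ x, f (r⁻¹ • (x - z)) = ENNReal.ofReal (r ^ dq) * ∫⁻ x, f x := by
  rw [lintegral_sub_right_eq_self (fun x => f (r⁻¹ • x)) z,
    ← lintegral_map (μ := volume) hf (measurable_const_smul r⁻¹),
    Measure.map_addHaar_smul _ (inv_ne_zero hr.ne'), lintegral_smul_measure, finrank_euclideanSpace,
    Fintype.card_fin, smul_eq_mul, inv_pow, inv_inv, abs_of_pos (by positivity)]

lemma setLIntegral_bump_rpow (hc : Continuous g) (hg : Function.support g ⊆ ball 0 1) (ζ : ℝ)
    {r p : ℝ} (hr : 0 < r) (hp : 0 < p) (z : EuclideanSpace ℝ (Fin dq)) :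
    ∫⁻ x in ball z r, ‖bump g ζ r z x‖ₑ ^ p
      = ENNReal.ofReal (r ^ dq) * (ENNReal.ofReal (r ^ ζ) ^ p * ∫⁻ x, ‖g x‖ₑ ^ p) := by
  rw [setLIntegral_eq_of_support_subset fun x hx => ?_]
  · simp_rw [enorm_bump ζ hr]
    rw [lintegral_comp_rescale (f := fun y => (ENNReal.ofReal (r ^ ζ) * ‖g y‖ₑ) ^ p)
      (by have := hc.measurable; fun_prop) hr]
    congr 1
    simp_rw [ENNReal.mul_rpow_of_nonneg _ _ hp.le]
    rw [lintegral_const_mul _ (by have := hc.measurable; fun_prop)]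
  · by_contra hx'
    apply hx
    simp [bump_eq_zero hg ζ hr hx', hp]

variable {J : ℕ} {z : Fin J → EuclideanSpace ℝ (Fin dq)} {r : ℝ}

lemma pairwise_disjoint_ball (hz : ∀ i j, i ≠ j → 2 * r ≤ ‖z i - z j‖) :
    Pairwise (Function.onFun Disjoint fun j => ball (z j) r) := by
  intro i j hij
  refine ball_disjoint_ball ?_
  rw [dist_eq_norm]
  linarith [hz i j hij]

lemma sum_bump_eq (hg : Function.support g ⊆ ball 0 1) (ζ : ℝ) (hr : 0 < r)
    (hz : ∀ i j, i ≠ j → 2 * r ≤ ‖z i - z j‖) (S : Finset (Fin J)) {j : Fin J}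
    {x : EuclideanSpace ℝ (Fin dq)} (hx : x ∈ ball (z j) r) :
    ∑ i ∈ S, bump g ζ r (z i) x = if j ∈ S then bump g ζ r (z j) x else 0 := by
  have h0 (i : Fin J) (hij : i ≠ j) : bump g ζ r (z i) x = 0 :=
    bump_eq_zero hg ζ hr (disjoint_left.1 (pairwise_disjoint_ball hz hij.symm) hx)
  split_ifs with hj
  · exact Finset.sum_eq_single_of_mem j hj fun i _ => h0 i
  · exact Finset.sum_eq_zero fun i hi => h0 i fun h => hj (h ▸ hi)

/-- The `L^p`-distance of superpositions of bumps with disjoint supports. -/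
lemma le_eLpNorm_sum_bump_sub (hc : Continuous g) (hg : Function.support g ⊆ ball 0 1) (ζ : ℝ)
    (hr : 0 < r) {p : ℝ} (hp : 1 ≤ p) (hz : ∀ i j, i ≠ j → 2 * r ≤ ‖z i - z j‖)
    {D : Set (EuclideanSpace ℝ (Fin dq))} (hD : ∀ j, ball (z j) r ⊆ D) (S T : Finset (Fin J)) :
    ENNReal.ofReal ((((symmDiff S T).card : ℝ) * r ^ dq) ^ (1 / p)) *
        eLpNorm g (ENNReal.ofReal p) volume * ENNReal.ofReal (r ^ ζ)
      ≤ eLpNorm (fun x => ∑ i ∈ S, bump g ζ r (z i) x - ∑ i ∈ T, bump g ζ r (z i) x)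
        (ENNReal.ofReal p) (volume.restrict D) := by
  have hp0 : 0 < p := by linarith
  have hp1 : ENNReal.ofReal p ≠ 0 := by simpa using hp0
  rw [eLpNorm_eq_lintegral_rpow_enorm_toReal hp1 ENNReal.ofReal_ne_top,
    eLpNorm_eq_lintegral_rpow_enorm_toReal hp1 ENNReal.ofReal_ne_top, ENNReal.toReal_ofReal hp0.le]
  -- On a ball indexed by `symmDiff S T` the difference is plus or minus a single bump, and each
  -- such ball contributes the same integral.
  have hlow : ((symmDiff S T).card : ℝ≥0∞) *
        (ENNReal.ofReal (r ^ dq) * (ENNReal.ofReal (r ^ ζ) ^ p * ∫⁻ x, ‖g x‖ₑ ^ p))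
      ≤ ∫⁻ x in D, ‖∑ i ∈ S, bump g ζ r (z i) x - ∑ i ∈ T, bump g ζ r (z i) x‖ₑ ^ p := by
    calc _ = ∑ j ∈ symmDiff S T, ∫⁻ x in ball (z j) r, ‖bump g ζ r (z j) x‖ₑ ^ p := by
          simp_rw [setLIntegral_bump_rpow hc hg ζ hr hp0]
          rw [Finset.sum_const, nsmul_eq_mul]
      _ = ∑ j ∈ symmDiff S T, ∫⁻ x in ball (z j) r,
            ‖∑ i ∈ S, bump g ζ r (z i) x - ∑ i ∈ T, bump g ζ r (z i) x‖ₑ ^ p := by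
          refine Finset.sum_congr rfl fun j hj => setLIntegral_congr_fun measurableSet_ball ?_
          intro x hx
          simp only [sum_bump_eq hg ζ hr hz _ hx]
          rcases Finset.mem_symmDiff.1 hj with ⟨h1, h2⟩ | ⟨h1, h2⟩ <;> simp [h1, h2]
      _ = ∫⁻ x in ⋃ j ∈ symmDiff S T, ball (z j) r,
            ‖∑ i ∈ S, bump g ζ r (z i) x - ∑ i ∈ T, bump g ζ r (z i) x‖ₑ ^ p :=
          (lintegral_biUnion_finset (fun i _ j _ hij => pairwise_disjoint_ball hz hij)
            (fun _ _ => measurableSet_ball) _).symm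
      _ ≤ _ := lintegral_mono_set (iUnion₂_subset fun j _ => hD j)
  refine le_trans (le_of_eq ?_) (ENNReal.rpow_le_rpow hlow (by positivity : 0 ≤ 1 / p))
  rw [← ENNReal.ofReal_rpow_of_nonneg (by positivity) (by positivity),
    ENNReal.ofReal_mul (by positivity), ENNReal.ofReal_natCast, ← mul_assoc,
    ENNReal.mul_rpow_of_nonneg _ _ (by positivity), ENNReal.mul_rpow_of_nonneg _ _ (by positivity),
    ENNReal.mul_rpow_of_nonneg _ _ (by positivity),
    ENNReal.mul_rpow_of_nonneg (ENNReal.ofReal (r ^ ζ) ^ p) _ (by positivity), ← ENNReal.rpow_mul, mul_one_div_cancel hp0.ne', ENNReal.rpow_one]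
  ring

end Bump

lemma half_mul_add_half_mul (G R : ℝ≥0∞) :
    ENNReal.ofReal (1 / 2) * G * R + ENNReal.ofReal (1 / 2) * G * R = R * G := by
  rw [mul_assoc, ← add_mul, ← ENNReal.ofReal_add (by norm_num) (by norm_num)]
  norm_num [mul_comm]

lemma enorm_sub_lt_add {E : Type*} [SeminormedAddCommGroup E] {a b c : E} {s : ℝ≥0∞}
    (hb : ‖a - b‖ₑ < s) (hc : ‖a - c‖ₑ < s) : ‖b - c‖ₑ < s + s := by
  rw [← edist_eq_enorm_sub] at *
  exact (edist_triangle_left b c a).trans_lt (ENNReal.add_lt_add hb hc)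

/-- The number of alternatives in a packing with `A = C₁ a / log a` dominates the information. -/
lemma information_le_half_log {a γ C c C₁ A J : ℝ} {d : ℕ} (hd : 0 < d) (hγ : 0 < γ) (hC : 0 < C)
    (hc : 0 < c) (hC₁ : C₁ = 12 * γ * C / d) (hA : A = C₁ * a * (Real.log a)⁻¹) (ha : 2 ≤ a)
    (ha' : (d / (12 * γ * C * c ^ (γ / d))) ^ 4 ≤ a) (hJ : c * A ^ (d / γ) ≤ J) :
    C * (a * A⁻¹) ≤ 1 / 2 * Real.log J := by
  have hd' : (0 : ℝ) < d := by exact_mod_cast hd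
  have hlog : 0 < Real.log a := Real.log_pos (by linarith)
  have ha0 : 0 < a := by linarith
  have hC₁0 : 0 < C₁ := by rw [hC₁]; positivity
  have hA0 : 0 < A := by rw [hA]; positivity
  have e1 : C * (a * A⁻¹) = d / γ * (Real.log a / 12) := by
    rw [hA, hC₁]; field_simp
  have h1 := Real.log_le_log (by positivity) hJ
  rw [Real.log_mul hc.ne' (by positivity), Real.log_rpow hA0] at h1
  have h2 := Real.log_le_log (by positivity) ha'
  have e2 : d / (12 * γ * C * c ^ (γ / d)) = (C₁ * c ^ (γ / d))⁻¹ := by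
    rw [hC₁]; field_simp
  rw [e2, Real.log_pow, Real.log_inv, Real.log_mul hC₁0.ne' (by positivity),
    Real.log_rpow hc] at h2
  have h3 : Real.log A = Real.log C₁ + Real.log a - Real.log (Real.log a) := by
    rw [hA, Real.log_mul (by positivity) (by positivity), Real.log_mul hC₁0.ne' ha0.ne',
      Real.log_inv]
    ring
  -- `log x ≤ x - 1` at `x = log a / 2`, with `log 2 < 1`.
  have h4 : Real.log (Real.log a) ≤ Real.log a / 2 := by
    have h5 := Real.log_le_sub_one_of_pos (half_pos hlog)
    rw [Real.log_div hlog.ne' (by norm_num)] at h5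
    linarith [Real.log_two_lt_d9]
  push_cast at h2
  -- The fourth power in `ha'` costs a quarter of `log a` and the iterated logarithm a half, so a
  -- quarter remains. Half of it, `log a / 8`, exceeds the required `log a / 12`.
  have h6 : d / γ * (Real.log a / 4) ≤ Real.log J := by
    calc d / γ * (Real.log a / 4)
        ≤ d / γ * (γ / d * Real.log c + Real.log A) := by
          gcongr; linarith
      _ = Real.log c + d / γ * Real.log A := by field_simp
      _ ≤ _ := h1
  have h7 : 0 ≤ d / γ * Real.log a := by positivity
  rw [e1]
  linarith

/-! ### Lower bounds for the three losses at a given radius -/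

namespace RegressionModel

variable {n dq du df : ℕ} {Θ : Type*} {M : RegressionModel n dq du df Θ}
  {P : Measure (EuclideanSpace ℝ (Fin du))} [IsProbabilityMeasure P]
  {g : EuclideanSpace ℝ (Fin dq) → EuclideanSpace ℝ (Fin df)} {v₀ : EuclideanSpace ℝ (Fin df)}
  {θ₀ : Θ} {alt : EuclideanSpace ℝ (Fin dq) → ℝ → Θ} {ζ ρlo ρhi a γ C : ℝ}

lemma BumpAlternatives.target_alt_sub_null (hb : M.BumpAlternatives g v₀ θ₀ alt ζ ρlo ρhi) {r : ℝ}
    (hr : r ∈ Ico ρlo ρhi) (z : EuclideanSpace ℝ (Fin dq)) {x : EuclideanSpace ℝ (Fin dq)}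
    (hx : x ∈ M.domain) : M.target (alt z r) x - M.target θ₀ x = bump g ζ r z x := by
  rw [hb.target_alt z r hr x hx, hb.target_null x hx, add_sub_cancel_right, bump]

/-- The lower bound for the pointwise loss. -/
lemma quarter_le_minimaxProb_pointLoss (hP : NoiseCondition P C)
    (hb : M.BumpAlternatives g v₀ θ₀ alt ζ ρlo ρhi) (hi : M.InformationBound θ₀ alt ρlo ρhi a γ)
    {r : ℝ} (hr : r ∈ Ico ρlo ρhi) (hr' : C * (a * r ^ γ) ≤ 1 / 2)
    {x₀ : EuclideanSpace ℝ (Fin dq)} (hx₀ : x₀ ∈ M.domain) :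
    1 / 4 ≤ minimaxProb (M.law P) Set.univ (M.pointLoss x₀)
      (ENNReal.ofReal (1 / 2) * (⨆ x, ‖g x‖ₑ) * ENNReal.ofReal (r ^ ζ)) := by
  have hr0 : 0 < r := hb.lo_pos.trans_le hr.1
  obtain ⟨y, -, hy⟩ := hb.exists_enorm_eq_iSup
  -- The center is chosen such that the bump peaks exactly at `x₀`.
  refine quarter_le_minimaxProb_of_pair θ₀ (alt (x₀ - r • y) r)
    ((hb.klDiv_alt_le hP hi hr _).trans (ENNReal.ofReal_le_ofReal hr')) fun F _ y' h0 h1 => ?_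
  have h := enorm_sub_lt_add h1 h0
  have hbump := bump_add_smul (g := g) ζ hr0 (x₀ - r • y) y
  rw [sub_add_cancel] at hbump
  rw [hb.target_alt_sub_null hr _ hx₀, hbump, hy, half_mul_add_half_mul] at h
  exact h.false

/-- The lower bound for the supremum loss. -/
lemma quarter_le_minimaxProb_supLoss (hP : NoiseCondition P C)
    (hb : M.BumpAlternatives g v₀ θ₀ alt ζ ρlo ρhi) (hi : M.InformationBound θ₀ alt ρlo ρhi a γ)
    {r : ℝ} (hr : r ∈ Ico ρlo ρhi) {J : ℕ} (hJ : 0 < J)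
    (hr' : C * (a * r ^ γ) ≤ 1 / 2 * Real.log J) {z : Fin J → EuclideanSpace ℝ (Fin dq)}
    (hz : ∀ i j, i ≠ j → 2 * r ≤ ‖z i - z j‖) (hD : ∀ j, ball (z j) r ⊆ M.domain) :
    1 / 4 ≤ minimaxProb (M.law P) Set.univ M.supLoss
      (ENNReal.ofReal (1 / 2) * (⨆ x, ‖g x‖ₑ) * ENNReal.ofReal (r ^ ζ)) := by
  have hr0 : 0 < r := hb.lo_pos.trans_le hr.1
  obtain ⟨y, hy1, hy⟩ := hb.exists_enorm_eq_iSup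
  have hmem (j : Fin J) : z j + r • y ∈ ball (z j) r := by
    rw [mem_ball_iff_norm, add_sub_cancel_left, norm_smul, Real.norm_of_nonneg hr0.le]
    exact mul_lt_of_lt_one_right hr0 (mem_ball_zero_iff.1 hy1)
  -- At the peak of bump `j`, both `θ₀` and every other alternative have the null value, so one
  -- comparison serves both separation conditions.
  have key (φ : EuclideanSpace ℝ (Fin dq) → EuclideanSpace ℝ (Fin df)) (j : Fin J) (θ : Θ)
      (hθ : M.target θ (z j + r • y) = M.target θ₀ (z j + r • y)) {s : ℝ≥0∞}
      (hs : s + s = ENNReal.ofReal (r ^ ζ) * ⨆ x, ‖g x‖ₑ)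
      (h1 : M.supLoss φ (alt (z j) r) < s) (h0 : M.supLoss φ θ < s) : False := by
    have hx := hD j (hmem j)
    have hle (θ : Θ) : ‖φ (z j + r • y) - M.target θ (z j + r • y)‖ₑ ≤ M.supLoss φ θ :=
      le_iSup₂ (f := fun x _ => ‖φ x - M.target θ x‖ₑ) _ hx
    have h := enorm_sub_lt_add ((hle _).trans_lt h1) ((hle _).trans_lt h0)
    rw [hθ, hb.target_alt_sub_null hr _ hx, bump_add_smul ζ hr0, hy, hs] at h
    exact h.false
  have : Nonempty (Fin J) := ⟨⟨0, hJ⟩⟩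
  refine quarter_le_minimaxProb_of_family Finset.univ Finset.univ_nonempty θ₀
    (fun j => alt (z j) r) (fun j _ => ?_) (fun F _ y' j _ h0 h1 => ?_)
    (fun F _ y' i _ j _ hij h0 h1 => ?_)
  · rw [Finset.card_univ, Fintype.card_fin]
    exact (hb.klDiv_alt_le hP hi hr _).trans (ENNReal.ofReal_le_ofReal hr')
  · exact key _ j θ₀ rfl (half_mul_add_half_mul _ _) h1 h0
  · refine key _ i _ ?_ (half_mul_add_half_mul _ _) h0 h1
    rw [← sub_eq_zero, hb.target_alt_sub_null hr _ (hD i (hmem i))]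
    exact bump_eq_zero hb.support_ref ζ hr0
      (disjoint_left.1 (pairwise_disjoint_ball hz hij) (hmem i))

/-- Additivity is assumed for nonempty families indexed by `Fin J`; a subset is enumerated, and `θ₀`
itself serves for the empty one. -/
lemma Additive.exists_superposition (hadd : M.Additive θ₀ alt ρlo ρhi)
    (hb : M.BumpAlternatives g v₀ θ₀ alt ζ ρlo ρhi) {r : ℝ} (hr : r ∈ Ico ρlo ρhi) {J : ℕ}
    {z : Fin J → EuclideanSpace ℝ (Fin dq)} (hz : ∀ i j, i ≠ j → 2 * r ≤ ‖z i - z j‖)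
    (S : Finset (Fin J)) : ∃ θ : Θ,
      (∀ x ∈ M.domain, M.target θ x = M.target θ₀ x + ∑ j ∈ S, bump g ζ r (z j) x) ∧
      ∀ k, M.obs k θ - M.obs k θ₀ = ∑ j ∈ S, (M.obs k (alt (z j) r) - M.obs k θ₀) := by
  rcases S.eq_empty_or_nonempty with rfl | hS
  · exact ⟨θ₀, by simp, by simp⟩
  have hsum {E : Type} [AddCommGroup E] (f : Fin J → E) :
      ∑ i, f (S.equivFin.symm i) = ∑ j ∈ S, f j := by
    rw [Equiv.sum_comp S.equivFin.symm (fun j : S => f j), Finset.sum_coe_sort]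
  obtain ⟨θ, h1, h2, -⟩ := hadd r hr S.card (fun i => z (S.equivFin.symm i)) hS.card_pos
    fun i j hij => hz _ _ fun h => hij (S.equivFin.symm.injective (Subtype.ext h))
  refine ⟨θ, fun x hx => ?_, fun k => ?_⟩
  · rw [← sub_eq_iff_eq_add', h1 x hx,
      hsum fun j => M.target (alt (z j) r) x - M.target θ₀ x]
    exact Finset.sum_congr rfl fun j _ => hb.target_alt_sub_null hr _ hx
  · rw [h2 k, hsum fun j => M.obs k (alt (z j) r) - M.obs k θ₀]

/-- The lower bound for the `L^p`-loss. -/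
lemma quarter_le_minimaxProb_lpLoss (hP : NoiseCondition P C)
    (hb : M.BumpAlternatives g v₀ θ₀ alt ζ ρlo ρhi) (hi : M.InformationBound θ₀ alt ρlo ρhi a γ)
    (hadd : M.Additive θ₀ alt ρlo ρhi) {r : ℝ} (hr : r ∈ Ico ρlo ρhi) {J : ℕ} (hJ : 8 ≤ J)
    (hr' : C * (a * r ^ γ) ≤ 1 / 36) {z : Fin J → EuclideanSpace ℝ (Fin dq)}
    (hz : ∀ i j, i ≠ j → 2 * r ≤ ‖z i - z j‖) (hD : ∀ j, ball (z j) r ⊆ M.domain)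
    {p c : ℝ} (hp : 1 ≤ p) (hc : 0 < c) (hcJ : c ≤ J * r ^ dq) :
    1 / 4 ≤ minimaxProb (M.law P) M.measurableEstimators (M.lpLoss p)
      (ENNReal.ofReal (2 ^ (-1 - 3 / p) * c ^ (1 / p)) * eLpNorm g (ENNReal.ofReal p) volume *
        ENNReal.ofReal (r ^ ζ)) := by
  have hr0 : 0 < r := hb.lo_pos.trans_le hr.1
  have hp0 : 0 < p := by linarith
  have hp1 : 1 ≤ ENNReal.ofReal p := by simpa using hp
  choose θ hθ hobs using hadd.exists_superposition hb hr hz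
  obtain ⟨𝒞, hne, hcode₀, hcode, hlog⟩ := exists_code hJ
  have hmeas (θ : Θ) : AEStronglyMeasurable (M.target θ) (volume.restrict M.domain) :=
    (M.continuousOn_target θ).aestronglyMeasurable M.measurableSet_domain
  have key (F) (hF : F ∈ M.measurableEstimators (du := du)) (y) (S T : Finset (Fin J))
      (hST : (J : ℝ) / 8 ≤ (symmDiff S T).card) {s : ℝ≥0∞}
      (hs : s = ENNReal.ofReal (2 ^ (-1 - 3 / p) * c ^ (1 / p)) *
        eLpNorm g (ENNReal.ofReal p) volume * ENNReal.ofReal (r ^ ζ))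
      (h1 : M.lpLoss p (F y) (θ S) < s) (h2 : M.lpLoss p (F y) (θ T) < s) : False := by
    have hup : eLpNorm (fun x => ∑ i ∈ S, bump g ζ r (z i) x - ∑ i ∈ T, bump g ζ r (z i) x)
        (ENNReal.ofReal p) (volume.restrict M.domain) < s + s := by
      refine lt_of_le_of_lt ?_ (ENNReal.add_lt_add h2 h1)
      refine le_trans (le_of_eq ?_) (eLpNorm_sub_le ((hF y).sub (hmeas _)) ((hF y).sub (hmeas _))
        hp1)
      refine eLpNorm_congr_ae (ae_restrict_of_forall_mem M.measurableSet_domain fun x hx => ?_)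
      simp only [Pi.sub_apply, hθ _ x hx]
      abel
    refine (hup.trans_le ?_).not_ge
      (le_eLpNorm_sum_bump_sub hb.continuous_ref hb.support_ref ζ hr0 hp hz hD S T)
    rw [hs, ← add_mul, ← add_mul, ← ENNReal.ofReal_add (by positivity) (by positivity)]
    gcongr
    -- Twice the threshold constant is `(c / 8) ^ (1 / p)`; the `8` is the relative distance `J / 8`
    -- of the code.
    have e : 2 ^ (-1 - 3 / p) * c ^ (1 / p) + 2 ^ (-1 - 3 / p) * c ^ (1 / p)
        = (c / 8) ^ (1 / p) := by
      have h8 : (8 : ℝ) ^ (1 / p) = 2 ^ (3 / p) := by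
        rw [show (8 : ℝ) = 2 ^ (3 : ℝ) by norm_num, ← Real.rpow_mul (by norm_num)]
        congr 1; ring
      rw [Real.div_rpow hc.le (by norm_num), h8, Real.rpow_sub (by norm_num),
        Real.rpow_neg_one]
      ring
    rw [e]
    refine Real.rpow_le_rpow (by positivity) ?_ (by positivity)
    have := mul_le_mul_of_nonneg_right hST (by positivity : 0 ≤ r ^ dq)
    linarith
  refine quarter_le_minimaxProb_of_family 𝒞 hne (θ ∅) θ (fun S _ => ?_)
    (fun F hF y S hS h0 h1 => ?_) (fun F hF y S hS T hT hST h0 h1 => ?_)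
  -- The chosen `θ ∅` need not be `θ₀`, but its observed objects agree with those of `θ₀`.
  · have hlaw : M.law P (θ ∅) = M.law P θ₀ := by
      unfold law
      congr! 4 with k
      simpa [sub_eq_zero] using hobs ∅ k
    rw [hlaw]
    refine (hb.klDiv_superposition_le hP hi hr hz S (hobs S)).trans (ENNReal.ofReal_le_ofReal ?_)
    -- The bound `1 / 36` per bump is half of the code rate `1 / 18`.
    have hJ0 : (0 : ℝ) ≤ J := Nat.cast_nonneg J
    nlinarith
  · refine key F hF y S ∅ ?_ rfl h1 h0
    rw [← Finset.bot_eq_empty, symmDiff_bot]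
    exact hcode₀ S hS
  · exact key F hF y S T (hcode S hS T hT hST) rfl h0 h1

end RegressionModel

/-! ### Choice of the radius and conclusion -/

theorem mainTheorem3 {n dq du df : ℕ} (hn : 0 < n) (hdq : 0 < dq) (hdu : 0 < du) (hdf : 0 < df)
    {Θ : Type*} (M : RegressionModel n dq du df Θ)
    (P : Measure (EuclideanSpace ℝ (Fin du))) [IsProbabilityMeasure P]
    (hPint : Integrable (fun x => x) P) (hPmean : ∫ x, x ∂P = 0)
    (Cnoise : ℝ) (hP : NoiseCondition P Cnoise)
    (g : EuclideanSpace ℝ (Fin dq) → EuclideanSpace ℝ (Fin df)) (v₀ : EuclideanSpace ℝ (Fin df))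
    (θ₀ : Θ) (alt : EuclideanSpace ℝ (Fin dq) → ℝ → Θ) (ζ ρlo ρhi a γ : ℝ)
    (hbump : M.BumpAlternatives g v₀ θ₀ alt ζ ρlo ρhi)
    (hinfo : M.InformationBound θ₀ alt ρlo ρhi a γ) :
    -- pointwise loss
    (∀ C₁ : ℝ, C₁ = 2 * Cnoise →
      C₁ * a ≤ ρlo ^ (-γ) → ρhi ^ (-γ) < C₁ * a →
      ∀ x₀ ∈ M.domain,
        1 / 4 ≤ minimaxProb (M.law P) Set.univ (M.pointLoss x₀)
          (ENNReal.ofReal (1 / 2) * (⨆ x, ‖g x‖ₑ) * ENNReal.ofReal ((C₁ * a) ^ (-ζ / γ)))) ∧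
    -- supremum loss
    (∀ Cpack : ℝ, M.PackingBound ρlo ρhi Cpack →
      ∀ C₁ : ℝ, C₁ = 12 * γ * Cnoise / dq →
      C₁ * a * (Real.log a)⁻¹ ≤ ρlo ^ (-γ) → ρhi ^ (-γ) < C₁ * a * (Real.log a)⁻¹ →
      max 2 ((dq / (12 * γ * Cnoise * Cpack ^ (γ / dq))) ^ 4) ≤ a →
        1 / 4 ≤ minimaxProb (M.law P) Set.univ M.supLoss
          (ENNReal.ofReal (1 / 2) * (⨆ x, ‖g x‖ₑ) *
            ENNReal.ofReal ((C₁ * a * (Real.log a)⁻¹) ^ (-ζ / γ)))) ∧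
    -- `L^p` loss
    (∀ p : ℝ, 1 ≤ p → ∀ Cpack : ℝ, M.PackingBound ρlo ρhi Cpack →
      M.Additive θ₀ alt ρlo ρhi →
      ∀ C₁ : ℝ, C₁ = 36 * Cnoise →
      C₁ * a ≤ ρlo ^ (-γ) → ρhi ^ (-γ) < C₁ * a →
      (Cpack / 8) ^ (-γ / dq) ≤ C₁ * a →
        1 / 4 ≤ minimaxProb (M.law P) M.measurableEstimators (M.lpLoss p)
          (ENNReal.ofReal (2 ^ (-1 - 3 / p) * Cpack ^ (1 / p)) *
            eLpNorm g (ENNReal.ofReal p) volume *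
            ENNReal.ofReal ((C₁ * a) ^ (-ζ / γ)))) := by
  obtain ⟨ha, hγ, -⟩ := id hinfo
  have hC := hP.1
  have hdq' : (0 : ℝ) < dq := by exact_mod_cast hdq
  -- With `r ^ γ = A⁻¹`, the information `Cnoise * a * r ^ γ` equals `Cnoise / C₁` for `A = C₁ * a`:
  -- this is `1 / 2` for the pointwise and `1 / 36` for the `L^p` loss.
  have hradius (A : ℝ) (hA : 0 < A) (h1 : A ≤ ρlo ^ (-γ)) (h2 : ρhi ^ (-γ) < A) :
      ∃ r ∈ Ico ρlo ρhi, 0 < r ∧ A ^ (-ζ / γ) = r ^ ζ ∧ r ^ γ = A⁻¹ ∧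
        r ^ (-(dq : ℝ)) = A ^ (dq / γ) := by
    obtain ⟨r, hr, h⟩ := exists_radius hA hγ hbump.lo_pos hbump.hi_pos h1 h2
    refine ⟨r, hr, hbump.lo_pos.trans_le hr.1, h ζ, ?_, ?_⟩
    · rw [← h γ, neg_div, div_self hγ.ne', Real.rpow_neg_one]
    · rw [← h, neg_neg]
  refine ⟨fun C₁ hC₁ h1 h2 x₀ hx₀ => ?_, fun Cpack hpack C₁ hC₁ h1 h2 h3 => ?_,
    fun p hp Cpack hpack hadd C₁ hC₁ h1 h2 h3 => ?_⟩
  · obtain ⟨r, hr, -, e1, e2, -⟩ := hradius (C₁ * a) (by rw [hC₁]; positivity) h1 h2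
    rw [e1]
    refine M.quarter_le_minimaxProb_pointLoss hP hbump hinfo hr (le_of_eq ?_) hx₀
    rw [e2, hC₁]
    field_simp
  · have ha2 := (le_max_left _ _).trans h3
    have hlog : 0 < Real.log a := Real.log_pos (by linarith)
    obtain ⟨r, hr, hr0, e1, e2, e3⟩ :=
      hradius (C₁ * a * (Real.log a)⁻¹) (by rw [hC₁]; positivity) h1 h2
    obtain ⟨J, z, hJ, hz, hD⟩ := hpack.exists_packing hr hr0
    have hJ0 : 0 < J := by
      have := hpack.1
      exact Nat.cast_pos.1 (lt_of_lt_of_le (by positivity) hJ)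
    rw [e1]
    refine M.quarter_le_minimaxProb_supLoss hP hbump hinfo hr hJ0 ?_ hz hD
    rw [e2]
    rw [e3] at hJ
    exact information_le_half_log hdq hγ hC hpack.1 hC₁ rfl ha2 ((le_max_right _ _).trans h3) hJ
  · obtain ⟨r, hr, hr0, e1, e2, e3⟩ := hradius (C₁ * a) (by rw [hC₁]; positivity) h1 h2
    obtain ⟨J, z, hJ, hz, hD⟩ := hpack.exists_packing hr hr0
    have hc := hpack.1
    -- Raised to the power `dq / γ`, the assumption `h3` reads `8 / Cpack ≤ r ^ (-dq)`: the packing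
    -- is large enough for the code.
    have hJ8 : 8 ≤ J := by
      have h4 := Real.rpow_le_rpow (by positivity) h3 (by positivity : 0 ≤ dq / γ)
      rw [← Real.rpow_mul (by positivity), show -γ / dq * (dq / γ) = -1 by field_simp,
        Real.rpow_neg_one, ← e3] at h4
      have h5 : (8 : ℝ) ≤ J := by
        calc (8 : ℝ) = Cpack * (Cpack / 8)⁻¹ := by field_simp
          _ ≤ Cpack * r ^ (-(dq : ℝ)) := by gcongr
          _ ≤ J := hJ
      exact_mod_cast h5
    rw [e1]
    refine M.quarter_le_minimaxProb_lpLoss hP hbump hinfo hadd hr hJ8 (le_of_eq ?_) hz hD hp hc ?_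
    · rw [e2, hC₁]
      field_simp
    · rwa [Real.rpow_neg hr0.le, Real.rpow_natCast, ← div_eq_mul_inv, div_le_iff₀ (by positivity)]
        at hJ
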